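/- For a nonzero polynomial $f(x)=c_1x^{\nu_1}+\cdots+c_tx^{\nu_t}$ with $c_1,\dots,c_t\neq 0$ and $0\le\nu_1<\cdots<\nu_t$, let $g(f)=\max_{1\le i<t}(\nu_{i+1}-\nu_i)$ if $t\neq1$, and $g(f)=0$ if $t=1$ (the maximum gap of $f$). Let $\Phi_n$ denote the $n$-th cyclotomic polynomial and $\varphi$ Euler's totient function. Then for every odd squarefree positive integer $m<1000$ (including $m=1$) and every odd prime $p$ that is larger than every prime factor of $m$, $$g(\Phi_{mp})=\varphi(m)\quad\text{if and only if}\quad p>m.$$ In other words, for all $k\ge 1$ and all odd primes $p_1<\cdots<p_k$ with $p_1\cdots p_{k-1}<1000$, $g(\Phi_{p_1\cdots p_k})=\varphi(p_1\cdots p_{k-1})$ if and only if $p_k>p_1\cdots p_{k-1}$. -/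

import Mathlib

/-- The maximum gap `g(f)` of a polynomial `f`: the largest difference `b - a` between two
consecutive exponents `a < b` of `f` (both occur in `f` with a nonzero coefficient and no exponent
strictly between them does). It is `0` when `f` has at most one term. -/
def maxGap {R : Type*} [Semiring R] (f : Polynomial R) : ℕ :=
  ((f.support ×ˢ f.support).filter
    (fun e => e.1 < e.2 ∧ ∀ c ∈ f.support, ¬ (e.1 < c ∧ c < e.2))).sup (fun e => e.2 - e.1)

open Polynomial

namespace CyclotomicGap

/-! ### A lower bound for the totient -/

/-! Everything rests on Φ_m(X^p) = Φ_{mp} Φ_m. Truncate Φ_{mp} just below the upper end k of a gap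
of length at least φ(m). Multiplying by Φ_m gives L(X^p) + c X^k with L a truncation of Φ_m, so L ≡
c' X^r modulo Φ_m (`exists_cyclotomic_dvd_lowPart_sub`). A gap longer than φ(m) forces c = 0, hence
L = 0, which is absurd. A gap equal to φ(m) forces L to be the first term of Φ_m or all terms but
the last (`lowPart_cyclotomic_eq_monomial`); both are impossible for p < m. To see this, multiply by
P = (X^m - 1)/Φ_m: then P L is c' times a cyclic shift of P, and any other L puts φ(m) consecutive
exponents with a single nonzero coefficient strictly inside P. The bound of `lt_two_mul_totient_or`
excludes that. For p > m, Φ_{mp} agrees below degree p with Φ_m(0) P/(X^m - 1), which shows a gap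
from deg P = m - φ(m) to m. -/

theorem exists_eq_minFac_mul {n : ℕ} (hn : Squarefree n) (h1 : n ≠ 1) :
    ∃ a, n = n.minFac * a ∧ Squarefree a ∧ n.totient = (n.minFac - 1) * a.totient ∧
      ∀ q, q.Prime → q ∣ a → n.minFac < q := by
  obtain ⟨a, ha⟩ := n.minFac_dvd
  have hp := Nat.minFac_prime h1
  have hsq : Squarefree (n.minFac * a) := ha ▸ hn
  have hcop : Nat.Coprime n.minFac a := Nat.coprime_of_squarefree_mul hsq
  refine ⟨a, ha, hsq.of_mul_right, ?_, fun q hq hqa => ?_⟩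
  · conv_lhs => rw [ha]
    rw [Nat.totient_mul hcop, Nat.totient_prime hp]
  · refine lt_of_le_of_ne (Nat.minFac_le_of_dvd hq.two_le (ha ▸ hqa.mul_left _)) ?_
    rintro rfl
    exact hp.one_lt.ne' (Nat.eq_one_of_dvd_coprimes hcop dvd_rfl hqa)

theorem add_two_le_of_odd_of_lt {p q : ℕ} (hp : Odd p) (hq : Odd q) (h : p < q) : p + 2 ≤ q := by
  rcases hp with ⟨a, rfl⟩
  rcases hq with ⟨b, rfl⟩
  omega

/-- As 3·5·7·11 = 1155, m has at most three prime factors, and m/φ(m) can exceed 2 only for three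
primes starting with 3. -/
theorem lt_two_mul_totient_or {m : ℕ} (hodd : Odd m) (hm : Squarefree m) (hlt : m < 1000) :
    m < 2 * m.totient ∨ ∃ n, m = 3 * n ∧ n < m.totient := by
  by_cases h1 : m = 1
  · subst h1; simp
  obtain ⟨a, hma, hsa, hta, hpa⟩ := exists_eq_minFac_mul hm h1
  have hp := Nat.minFac_prime h1
  have hpo : Odd m.minFac := hodd.of_dvd_nat m.minFac_dvd
  have hao : Odd a := hodd.of_dvd_nat (hma ▸ dvd_mul_left a _)
  generalize m.minFac = p at *
  have hp3 : 3 ≤ p := add_two_le_of_odd_of_lt odd_one hpo hp.one_lt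
  obtain ⟨p, rfl⟩ : ∃ k, p = k + 1 := ⟨p - 1, by omega⟩
  by_cases h2 : a = 1
  · subst h2
    left
    simp at hta hma
    omega
  obtain ⟨b, hab, hsb, htb, hqb⟩ := exists_eq_minFac_mul hsa h2
  have hq := Nat.minFac_prime h2
  have hqo : Odd a.minFac := hao.of_dvd_nat a.minFac_dvd
  have hbo : Odd b := hao.of_dvd_nat (hab ▸ dvd_mul_left b _)
  have hpq := add_two_le_of_odd_of_lt hpo hqo (hpa _ hq a.minFac_dvd)
  generalize a.minFac = q at *
  obtain ⟨q, rfl⟩ : ∃ k, q = k + 1 := ⟨q - 1, by omega⟩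
  by_cases h3 : b = 1
  · subst h3
    left
    simp at hta hma htb hab
    rw [hta, hma, htb, hab]
    nlinarith
  obtain ⟨c, hbc, hsc, htc, hrc⟩ := exists_eq_minFac_mul hsb h3
  have hr := Nat.minFac_prime h3
  have hro : Odd b.minFac := hbo.of_dvd_nat b.minFac_dvd
  have hco : Odd c := hbo.of_dvd_nat (hbc ▸ dvd_mul_left c _)
  have hqr := add_two_le_of_odd_of_lt hqo hro (hqb _ hr b.minFac_dvd)
  generalize b.minFac = r at *
  obtain ⟨r, rfl⟩ : ∃ k, r = k + 1 := ⟨r - 1, by omega⟩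
  by_cases h4 : c = 1
  · subst h4
    simp at hta hma htb hab htc hbc
    rw [hta, hma, htb, hab, htc, hbc]
    rcases hp3.eq_or_lt with h | h
    · obtain rfl : p = 2 := by omega
      right
      refine ⟨_, rfl, ?_⟩
      nlinarith
    · left
      have hp4 : 4 ≤ p := by
        have := add_two_le_of_odd_of_lt (by decide) hpo h
        omega
      -- The primes are at least 5, 7, 9, so m/φ(m) ≤ 315/192 < 2.
      have hpq' : 4 * 6 * ((p + 1) * (q + 1)) ≤ 5 * 7 * (p * q) := by
        calc 4 * 6 * ((p + 1) * (q + 1)) = (4 * (p + 1)) * (6 * (q + 1)) := by ring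
          _ ≤ (5 * p) * (7 * q) := Nat.mul_le_mul (by omega) (by omega)
          _ = _ := by ring
      have h24 : 24 * 8 * ((p + 1) * ((q + 1) * (r + 1))) ≤ 35 * 9 * (p * (q * r)) := by
        calc 24 * 8 * ((p + 1) * ((q + 1) * (r + 1)))
            = (4 * 6 * ((p + 1) * (q + 1))) * (8 * (r + 1)) := by ring
          _ ≤ (5 * 7 * (p * q)) * (9 * r) := Nat.mul_le_mul hpq' (by omega)
          _ = _ := by ring
      have hpos : 0 < p * (q * r) := by
        have : 0 < q := by omega
        have : 0 < r := by omega
        positivity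
      omega
  · exfalso
    have hs := Nat.minFac_prime h4
    have hrs := add_two_le_of_odd_of_lt hro (hco.of_dvd_nat c.minFac_dvd) (hrc _ hs c.minFac_dvd)
    have hc9 : 9 ≤ c := le_trans (by omega) (Nat.minFac_le hco.pos)
    have hc : 11 ≤ c := by
      by_contra hlt'
      have h9 : c = 9 ∨ c = 10 := by omega
      rcases h9 with rfl | rfl
      · exact absurd (hsc 3 (by decide)) (by decide)
      · exact absurd hco (by decide)
    have hb : 7 * 11 ≤ b := hbc ▸ Nat.mul_le_mul (by omega) hc
    have ha : 5 * (7 * 11) ≤ a := hab ▸ Nat.mul_le_mul (by omega) hb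
    have hm' : 3 * (5 * (7 * 11)) ≤ m := hma ▸ Nat.mul_le_mul (by omega) ha
    omega

/-! ### Truncations and coefficients -/

theorem coeff_mul_congr {R : Type*} [Semiring R] (f : R[X]) {g h : R[X]} {n : ℕ}
    (hgh : ∀ i ≤ n, g.coeff i = h.coeff i) : (f * g).coeff n = (f * h).coeff n := by
  rw [coeff_mul, coeff_mul]
  refine Finset.sum_congr rfl fun x hx => ?_
  rw [hgh _ (by have := Finset.HasAntidiagonal.mem_antidiagonal.mp hx; omega)]

/-- The sum of the terms of `f` of degree less than `n`. -/
noncomputable def lowPart (n : ℕ) (f : ℤ[X]) : ℤ[X] := ∑ i ∈ Finset.range n, monomial i (f.coeff i)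

theorem coeff_lowPart (n : ℕ) (f : ℤ[X]) (i : ℕ) :
    (lowPart n f).coeff i = if i < n then f.coeff i else 0 := by
  simp [lowPart, coeff_monomial]

theorem natDegree_lowPart_succ_le (n : ℕ) (f : ℤ[X]) : (lowPart (n + 1) f).natDegree ≤ n := by
  rw [natDegree_le_iff_coeff_eq_zero]
  intro k hk
  rw [coeff_lowPart, if_neg (by omega)]

/-- Congruence modulo `X ^ m - 1` identifies coefficients up to a cyclic shift. -/
theorem coeff_eq_of_X_pow_sub_one_dvd {m r : ℕ} {S P : ℤ[X]} {c : ℤ} (hr : r < m)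
    (hS : ∀ i, m ≤ i → S.coeff i = 0) (hP : ∀ i, m ≤ i → P.coeff i = 0)
    (h : (X ^ m - 1 : ℤ[X]) ∣ S - C c * (X ^ r * P)) {i : ℕ} (hi : i < m) :
    S.coeff i = c * if r ≤ i then P.coeff (i - r) else P.coeff (i + m - r) := by
  obtain ⟨Q, hQ⟩ := h
  have key : ∀ k, S.coeff k - c * (if r ≤ k then P.coeff (k - r) else 0)
      = (if m ≤ k then Q.coeff (k - m) else 0) - Q.coeff k := by
    intro k
    have := congrArg (fun f => f.coeff k) hQ
    simpa only [coeff_sub, coeff_C_mul, coeff_X_pow_mul', sub_mul, one_mul] using this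
  -- Otherwise (X^m - 1) Q has degree at least 2m, beyond both S and X^r P.
  have hvan : ∀ k, m ≤ k → Q.coeff k = 0 := by
    by_contra! hne
    obtain ⟨k, hk, hne⟩ := hne
    have hQ0 : Q ≠ 0 := by rintro rfl; simp at hne
    have hdeg : k ≤ Q.natDegree := le_natDegree_of_ne_zero hne
    have := key (Q.natDegree + m)
    rw [hS _ (by omega), if_pos (by omega), hP _ (by omega), if_pos (by omega),
      Nat.add_sub_cancel, coeff_eq_zero_of_natDegree_lt (n := Q.natDegree + m) (by omega)] at this
    exact hQ0 (leadingCoeff_eq_zero.mp (by rw [leadingCoeff]; linarith))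
  have h1 := key i
  have h2 := key (i + m)
  rw [if_neg (show ¬ m ≤ i by omega)] at h1
  rw [hS _ (by omega), if_pos (by omega), if_pos (by omega), Nat.add_sub_cancel,
    hvan (i + m) (by omega)] at h2
  split_ifs with hri
  · rw [if_pos hri] at h1
    rw [hP _ (by omega)] at h2
    linarith
  · rw [if_neg hri] at h1
    linarith

/-! ### Cyclotomic polynomials and their complements -/

theorem cyclotomic_coeff_zero_ne_zero {m : ℕ} (hm : 0 < m) :
    (cyclotomic m ℤ).coeff 0 ≠ 0 := by
  rcases Nat.lt_or_ge 1 m with h | h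
  · simp [cyclotomic_coeff_zero ℤ h]
  · obtain rfl : m = 1 := by omega
    simp

theorem exists_prime_mul_of_squarefree {m : ℕ} (hm : Squarefree m) (h1 : m ≠ 1) :
    ∃ a q, q.Prime ∧ ¬ q ∣ a ∧ Squarefree a ∧ m = a * q := by
  obtain ⟨a, ha, hsa, -, hlt⟩ := exists_eq_minFac_mul hm h1
  exact ⟨a, _, Nat.minFac_prime h1, fun h => (hlt _ (Nat.minFac_prime h1) h).false, hsa,
    by rw [mul_comm]; exact ha⟩

/-- Induction on the prime factors: Φ_a(X^q) = Φ_{aq} Φ_a has no linear term. -/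
theorem cyclotomic_coeff_one_ne_zero {m : ℕ} (hm : Squarefree m) :
    (cyclotomic m ℤ).coeff 1 ≠ 0 := by
  induction m using Nat.strong_induction_on with
  | _ m ih =>
    by_cases h1 : m = 1
    · subst h1; simp [coeff_one]
    obtain ⟨a, q, hq, hqa, hsa, rfl⟩ := exists_prime_mul_of_squarefree hm h1
    have ha0 : 0 < a := Nat.pos_of_ne_zero hsa.ne_zero
    have ih' := ih a (lt_mul_of_one_lt_right ha0 hq.one_lt) hsa
    have h := congrArg (fun f => f.coeff 1) (cyclotomic_expand_eq_cyclotomic_mul hq hqa ℤ)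
    simp only [coeff_expand hq.pos, mul_coeff_one, Nat.dvd_one, hq.one_lt.ne', if_false] at h
    intro h0
    rw [h0, zero_mul, add_zero] at h
    exact mul_ne_zero (cyclotomic_coeff_zero_ne_zero (Nat.mul_pos ha0 hq.pos)) ih' h.symm

theorem nextCoeff_expand {q : ℕ} (hq : 1 < q) (f : ℤ[X]) : (expand ℤ q f).nextCoeff = 0 := by
  rw [nextCoeff, natDegree_expand]
  split_ifs with h
  · rfl
  · rw [coeff_expand (by omega), if_neg]
    intro hd
    have h2 : q ∣ f.natDegree * q := dvd_mul_left _ _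
    have := (Nat.dvd_sub_iff_right (Nat.one_le_iff_ne_zero.mpr h) h2).mp hd
    exact hq.ne' (Nat.dvd_one.mp this)

theorem cyclotomic_nextCoeff_ne_zero {m : ℕ} (hm : Squarefree m) :
    (cyclotomic m ℤ).nextCoeff ≠ 0 := by
  induction m using Nat.strong_induction_on with
  | _ m ih =>
    by_cases h1 : m = 1
    · subst h1
      rw [cyclotomic_one, ← C_1, nextCoeff_X_sub_C]
      decide
    obtain ⟨a, q, hq, hqa, hsa, rfl⟩ := exists_prime_mul_of_squarefree hm h1
    have ha0 : 0 < a := Nat.pos_of_ne_zero hsa.ne_zero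
    have ih' := ih a (lt_mul_of_one_lt_right ha0 hq.one_lt) hsa
    have h := nextCoeff_expand hq.one_lt (cyclotomic a ℤ)
    rw [cyclotomic_expand_eq_cyclotomic_mul hq hqa,
      (cyclotomic.monic _ ℤ).nextCoeff_mul (cyclotomic.monic _ ℤ)] at h
    intro h0
    rw [h0, zero_add] at h
    exact ih' h

section Complement

variable {m : ℕ} {P : ℤ[X]}

theorem complement_monic (hm : 0 < m) (hP : cyclotomic m ℤ * P = X ^ m - 1) : P.Monic :=
  (cyclotomic.monic m ℤ).of_mul_monic_left (hP ▸ monic_X_pow_sub_C 1 hm.ne')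

theorem complement_natDegree (hm : 0 < m) (hP : cyclotomic m ℤ * P = X ^ m - 1) :
    m.totient + P.natDegree = m := by
  have h := congrArg natDegree hP
  rw [(cyclotomic.monic m ℤ).natDegree_mul (complement_monic hm hP), natDegree_cyclotomic] at h
  exact h.trans (natDegree_X_pow_sub_C (r := (1 : ℤ)))

theorem complement_coeff_zero_ne_zero (hm : 0 < m) (hP : cyclotomic m ℤ * P = X ^ m - 1) :
    P.coeff 0 ≠ 0 := by
  intro h0
  have h := congrArg (fun f => f.coeff 0) hP
  simp [mul_coeff_zero, h0, coeff_X_pow, hm.ne] at h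

theorem complement_coeff_one_ne_zero (hm : 1 < m) (hs : Squarefree m)
    (hP : cyclotomic m ℤ * P = X ^ m - 1) : P.coeff 1 ≠ 0 := by
  intro h1
  have h := congrArg (fun f => f.coeff 1) hP
  simp only [mul_coeff_one, h1, mul_zero, zero_add, coeff_sub, coeff_X_pow, hm.ne, if_false,
    coeff_one, one_ne_zero, sub_zero] at h
  exact mul_ne_zero (cyclotomic_coeff_one_ne_zero hs)
    (complement_coeff_zero_ne_zero (by omega) hP) h

theorem complement_nextCoeff_ne_zero (hm : 1 < m) (hs : Squarefree m)
    (hP : cyclotomic m ℤ * P = X ^ m - 1) : P.nextCoeff ≠ 0 := by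
  intro h1
  have h := congrArg nextCoeff hP
  have h2 : (X ^ m - 1 : ℤ[X]).nextCoeff = 0 := by
    have := nextCoeff_expand hm (X - 1)
    simpa using this
  rw [(cyclotomic.monic m ℤ).nextCoeff_mul (complement_monic (by omega) hP), h2, h1,
    add_zero] at h
  exact cyclotomic_nextCoeff_ne_zero hs h

/-- If `m = 3 * n` and `n < φ(m)`, then `(X ^ m - 1) / Φ_m` has nonzero coefficients at the
exponents `n` and `2 * n - φ(m) < n`. -/
theorem complement_coeff_ne_zero_of_three_mul {n : ℕ} (hm : m = 3 * n) (hn : n < m.totient)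
    (hn0 : 0 < n) (hP : cyclotomic m ℤ * P = X ^ m - 1) :
    m.totient ≤ 2 * n ∧ P.coeff n ≠ 0 ∧ P.coeff (2 * n - m.totient) ≠ 0 := by
  have hm0 : 0 < m := by omega
  have hdvd : n ∈ m.properDivisors :=
    Nat.mem_properDivisors.mpr ⟨hm ▸ dvd_mul_left n 3, by omega⟩
  obtain ⟨H, hH⟩ := X_pow_sub_one_mul_cyclotomic_dvd_X_pow_sub_one_of_dvd ℤ hdvd
  have hPH : P = (X ^ n - 1) * H := by
    apply mul_left_cancel₀ (cyclotomic_ne_zero m ℤ)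
    rw [hP, hH]
    ring
  have hXn : (X ^ n - 1 : ℤ[X]).Monic := monic_X_pow_sub_C 1 hn0.ne'
  have hHm : H.Monic := hXn.of_mul_monic_left (hPH ▸ complement_monic hm0 hP)
  have hdeg : n + H.natDegree = P.natDegree := by
    rw [hPH, hXn.natDegree_mul hHm]
    congr 1
    exact (natDegree_X_pow_sub_C (r := (1 : ℤ))).symm
  have hdegP := complement_natDegree hm0 hP
  have hcoeff : ∀ k, P.coeff k = (if n ≤ k then H.coeff (k - n) else 0) - H.coeff k := by
    intro k
    rw [hPH, sub_mul, one_mul, coeff_sub, coeff_X_pow_mul']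
  have hHdeg : H.natDegree = 2 * n - m.totient := by omega
  refine ⟨by omega, ?_, ?_⟩
  · rw [hcoeff, if_pos le_rfl, Nat.sub_self,
      coeff_eq_zero_of_natDegree_lt (n := n) (by omega), sub_zero]
    have h0 := complement_coeff_zero_ne_zero hm0 hP
    rw [hcoeff, if_neg (by omega), zero_sub] at h0
    exact neg_ne_zero.mp h0
  · rw [hcoeff, if_neg (by omega), ← hHdeg, hHm.coeff_natDegree]
    decide

/-- A proper truncation of `Φ_m` is a multiple of a power of `X` modulo `Φ_m` only if it consists
of the first term or of all terms but the last. -/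
theorem lowPart_cyclotomic_eq_monomial (hm : 1 < m) (hs : Squarefree m)
    (hbound : m < 2 * m.totient ∨ ∃ n, m = 3 * n ∧ n < m.totient)
    {j r : ℕ} {c : ℤ} (hj : j < m.totient) (hr : r < m)
    (h : cyclotomic m ℤ ∣ lowPart (j + 1) (cyclotomic m ℤ) - C c * X ^ r) :
    j = 0 ∧ r = 0 ∨ j + 1 = m.totient ∧ r = m.totient := by
  have hm0 : 0 < m := by omega
  obtain ⟨P, hP'⟩ := cyclotomic.dvd_X_pow_sub_one m ℤ
  have hP : cyclotomic m ℤ * P = X ^ m - 1 := hP'.symm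
  have hmonic := complement_monic hm0 hP
  have hdeg := complement_natDegree hm0 hP
  have hP0 := complement_coeff_zero_ne_zero hm0 hP
  have hPD : P.coeff P.natDegree ≠ 0 := by rw [hmonic.coeff_natDegree]; decide
  have hPlarge : ∀ i, P.natDegree < i → P.coeff i = 0 := fun i => coeff_eq_zero_of_natDegree_lt
  set S := P * lowPart (j + 1) (cyclotomic m ℤ) with hS
  have hSlow : ∀ i ≤ j, S.coeff i = (X ^ m - 1 : ℤ[X]).coeff i := by
    intro i hi
    rw [← hP, mul_comm, hS]
    refine coeff_mul_congr P fun k hk => ?_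
    rw [coeff_lowPart, if_pos (by omega)]
  have hSlarge : ∀ i, P.natDegree + j < i → S.coeff i = 0 := by
    intro i hi
    refine coeff_eq_zero_of_natDegree_lt (lt_of_le_of_lt natDegree_mul_le ?_)
    have := natDegree_lowPart_succ_le j (cyclotomic m ℤ)
    omega
  have hS0 : S.coeff 0 ≠ 0 := by
    rw [hSlow 0 (Nat.zero_le _)]
    simp [coeff_X_pow, hm0.ne]
  have hSzero : ∀ i, 0 < i → i ≤ j → S.coeff i = 0 := by
    intro i hi hij
    rw [hSlow i hij]
    simp only [coeff_sub, coeff_X_pow, coeff_one]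
    rw [if_neg (by omega), if_neg (by omega), sub_zero]
  have hshift : ∀ i, i < m →
      S.coeff i = c * if r ≤ i then P.coeff (i - r) else P.coeff (i + m - r) := by
    intro i hi
    refine coeff_eq_of_X_pow_sub_one_dvd hr (fun i hi => hSlarge i (by omega))
      (fun i hi => hPlarge i (by omega)) ?_ hi
    obtain ⟨Q, hQ⟩ := h
    refine ⟨Q, ?_⟩
    rw [hS, ← hP]
    linear_combination P * hQ
  have hc : c ≠ 0 := by
    rintro rfl
    exact hS0 (by rw [hshift 0 hm0, zero_mul])
  have hzero : ∀ i, i < m → S.coeff i = 0 →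
      (if r ≤ i then P.coeff (i - r) else P.coeff (i + m - r)) = 0 := by
    intro i hi h0
    rw [hshift i hi] at h0
    exact (mul_eq_zero.mp h0).resolve_left hc
  rcases Nat.eq_zero_or_pos r with rfl | hr0
  · refine Or.inl ⟨?_, rfl⟩
    by_contra hj0
    have := hzero 1 hm (hSzero 1 one_pos (by omega))
    rw [if_pos (by omega)] at this
    exact complement_coeff_one_ne_zero hm hs hP this
  -- Exponent t of P lands on exponent 0 of S. The zeros of S cyclically around 0 become zeros of P
  -- around t: j above it and up to φ(m) - 1 - j below.
  obtain ⟨t, ht⟩ : ∃ t, r + t = m := ⟨m - r, by omega⟩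
  have hPt : P.coeff t ≠ 0 := by
    intro h0
    apply hS0
    rw [hshift 0 hm0, if_neg (by omega), show 0 + m - r = t by omega, h0, mul_zero]
  have htD : t ≤ P.natDegree := le_natDegree_of_ne_zero hPt
  have hright : ∀ i, 0 < i → i ≤ j → P.coeff (t + i) = 0 := by
    intro i hi hij
    have := hzero i (by omega) (hSzero i hi hij)
    rwa [if_neg (by omega), show i + m - r = t + i by omega] at this
  have hleft : ∀ u, 0 < u → u + j < m.totient → u ≤ t → P.coeff (t - u) = 0 := by
    intro u hu huj hut
    have := hzero (m - u) (by omega) (hSlarge _ (by omega))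
    rwa [if_pos (by omega), show m - u - r = t - u by omega] at this
  have htj : m.totient ≤ t + j := by
    by_contra hlt
    have := hleft t (by omega) (by omega) le_rfl
    rw [Nat.sub_self] at this
    exact hP0 this
  have hwindow : ∀ i, P.coeff i ≠ 0 → t + 1 + j ≤ i + m.totient → i ≤ t + j → i = t := by
    intro i hi h1 h2
    rcases lt_trichotomy i t with hlt | heq | hgt
    · refine absurd (hleft (t - i) (by omega) (by omega) (by omega)) ?_
      rwa [show t - (t - i) = i by omega]
    · exact heq
    · refine absurd (hright (i - t) (by omega) (by omega)) ?_
      rwa [show t + (i - t) = i by omega]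
  rcases htD.eq_or_lt with heq | hlt
  · right
    have hj' : j + 1 = m.totient := by
      by_contra hne
      refine complement_nextCoeff_ne_zero hm hs hP ?_
      rw [nextCoeff_of_natDegree_pos (by omega), ← heq]
      exact hleft 1 one_pos (by omega) (by omega)
    exact ⟨hj', by omega⟩
  · exfalso
    have htD' : t + j < P.natDegree := by
      by_contra hge
      exact hlt.ne' (hwindow _ hPD (by omega) (by omega))
    -- Now φ(m) ≤ t + j < deg P = m - φ(m), so m > 2φ(m). If m = 3n, both n and 2n - φ(m) lie in the
    -- window, whose only nonzero exponent is t.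
    rcases hbound with hb | ⟨n, hmn, hn⟩
    · omega
    · obtain ⟨hle, hn1, hn2⟩ := complement_coeff_ne_zero_of_three_mul hmn hn (by omega) hP
      have e1 := hwindow _ hn1 (by omega) (by omega)
      have e2 := hwindow _ hn2 (by omega) (by omega)
      omega

end Complement

/-! ### Gaps of `Φ_{mp}` -/

/-- `a < b` are consecutive exponents of `f`. -/
def IsGap (f : ℤ[X]) (a b : ℕ) : Prop :=
  a < b ∧ f.coeff a ≠ 0 ∧ f.coeff b ≠ 0 ∧ ∀ i, a < i → i < b → f.coeff i = 0

theorem mem_filter_iff_isGap (f : ℤ[X]) (e : ℕ × ℕ) :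
    e ∈ (f.support ×ˢ f.support).filter
      (fun e => e.1 < e.2 ∧ ∀ c ∈ f.support, ¬ (e.1 < c ∧ c < e.2)) ↔ IsGap f e.1 e.2 := by
  simp only [IsGap, Finset.mem_filter, Finset.mem_product, mem_support_iff]
  constructor
  · rintro ⟨⟨h1, h2⟩, h3, h4⟩
    exact ⟨h3, h1, h2, fun i hi hi' => by_contra fun h => h4 i h ⟨hi, hi'⟩⟩
  · rintro ⟨h3, h1, h2, h4⟩
    exact ⟨⟨h1, h2⟩, h3, fun c hc h => hc (h4 c h.1 h.2)⟩

theorem exists_isGap_of_maxGap_eq {f : ℤ[X]} {d : ℕ} (hd : 0 < d) (h : maxGap f = d) :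
    ∃ a, IsGap f a (a + d) := by
  rw [maxGap] at h
  set G := (f.support ×ˢ f.support).filter
    (fun e => e.1 < e.2 ∧ ∀ c ∈ f.support, ¬ (e.1 < c ∧ c < e.2))
  have hne : G.Nonempty := by
    rw [Finset.nonempty_iff_ne_empty]
    intro h0
    rw [h0, Finset.sup_empty] at h
    exact hd.ne h
  obtain ⟨e, he, hed⟩ := Finset.exists_mem_eq_sup G hne (fun e : ℕ × ℕ => e.2 - e.1)
  rw [h] at hed
  rw [mem_filter_iff_isGap] at he
  refine ⟨e.1, ?_⟩
  have : e.1 + d = e.2 := by have := he.1; omega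
  rwa [this]

theorem maxGap_eq_of_isGap {f : ℤ[X]} {a d : ℕ} (h : IsGap f a (a + d))
    (hle : ∀ a b, IsGap f a b → b ≤ a + d) : maxGap f = d := by
  rw [maxGap]
  apply le_antisymm
  · refine Finset.sup_le fun e he => ?_
    rw [mem_filter_iff_isGap] at he
    have := hle _ _ he
    omega
  · have := Finset.le_sup (f := fun e : ℕ × ℕ => e.2 - e.1) ((mem_filter_iff_isGap f (a, a + d)).mpr h)
    simpa using this

theorem natDegree_lowPart_le_of_isGap {f : ℤ[X]} {a k : ℕ} (hgap : IsGap f a k) :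
    (lowPart k f).natDegree ≤ a := by
  rw [natDegree_le_iff_coeff_eq_zero]
  intro i hi
  rw [coeff_lowPart]
  split_ifs with hik
  · exact hgap.2.2.2 i hi hik
  · rfl

section Gaps

variable {m p : ℕ}

/-- Below k the truncation does not affect the product, and its degree is at most a + φ(m) ≤ k.
Cutting Φ_m after (k - 1)/p leaves the whole X^k term to the monomial. -/
theorem cyclotomic_mul_lowPart_eq (hp : p.Prime) (hpm : ¬ p ∣ m) {a k : ℕ}
    (hgap : IsGap (cyclotomic (m * p) ℤ) a k) (hk : a + m.totient ≤ k) :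
    cyclotomic m ℤ * lowPart k (cyclotomic (m * p) ℤ) =
      expand ℤ p (lowPart ((k - 1) / p + 1) (cyclotomic m ℤ)) +
        C ((cyclotomic m ℤ * lowPart k (cyclotomic (m * p) ℤ)).coeff k) * X ^ k := by
  have hk0 : 0 < k := by have := hgap.1; omega
  have hdeg := natDegree_lowPart_le_of_isGap hgap
  ext i
  rw [coeff_add, coeff_C_mul, coeff_X_pow, coeff_expand hp.pos, coeff_lowPart]
  rcases lt_trichotomy i k with hlt | rfl | hgt
  · rw [if_neg hlt.ne, mul_zero, add_zero,
      coeff_mul_congr (h := cyclotomic (m * p) ℤ) _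
        (fun l hl => by rw [coeff_lowPart, if_pos (by omega)]),
      mul_comm, ← cyclotomic_expand_eq_cyclotomic_mul hp hpm, coeff_expand hp.pos,
      if_pos (Nat.lt_succ_of_le (Nat.div_le_div_right (by omega)))]
  · have : ¬ (p ∣ i ∧ i / p < (i - 1) / p + 1) := by
      rintro ⟨⟨l, rfl⟩, hl⟩
      rw [Nat.mul_div_cancel_left _ hp.pos, Nat.lt_succ_iff, Nat.le_div_iff_mul_le hp.pos,
        mul_comm] at hl
      omega
    rw [← ite_and, if_neg this, if_pos rfl, mul_one, zero_add]
  · have : ¬ (p ∣ i ∧ i / p < (k - 1) / p + 1) := by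
      rintro ⟨⟨l, rfl⟩, hl⟩
      rw [Nat.mul_div_cancel_left _ hp.pos, Nat.lt_succ_iff, Nat.le_div_iff_mul_le hp.pos,
        mul_comm] at hl
      omega
    rw [← ite_and, if_neg this, if_neg hgt.ne', mul_zero, zero_add]
    refine coeff_eq_zero_of_natDegree_lt (lt_of_le_of_lt natDegree_mul_le ?_)
    rw [natDegree_cyclotomic]
    omega

theorem le_of_isGap (hp : p.Prime) (hpm : ¬ p ∣ m) {a k : ℕ}
    (hgap : IsGap (cyclotomic (m * p) ℤ) a k) : k ≤ m.totient * (p - 1) := by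
  have := le_natDegree_of_ne_zero hgap.2.2.1
  rwa [natDegree_cyclotomic,
    Nat.totient_mul (((Nat.Prime.coprime_iff_not_dvd hp).mpr hpm).symm),
    Nat.totient_prime hp] at this

theorem div_lt_totient_of_isGap (hp : p.Prime) (hpm : ¬ p ∣ m) {a k : ℕ}
    (hgap : IsGap (cyclotomic (m * p) ℤ) a k) : (k - 1) / p < m.totient := by
  have h1 := le_of_isGap hp hpm hgap
  have h2 : m.totient * (p - 1) ≤ m.totient * p := Nat.mul_le_mul_left _ (Nat.sub_le _ _)
  have := hgap.1
  rw [Nat.div_lt_iff_lt_mul hp.pos]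
  omega

/-- If `p * q ≡ 1` modulo `m`, then the substitution `X ↦ X ^ q` turns a divisibility
`Φ_m ∣ f(X ^ p) + c X ^ k` into `Φ_m ∣ f + c X ^ (q * k % m)`. -/
theorem cyclotomic_dvd_of_dvd_expand (hm : 0 < m) {q k : ℕ} (hpq : p * q ≡ 1 [MOD m])
    {f : ℤ[X]} {c : ℤ} (h : cyclotomic m ℤ ∣ expand ℤ p f + C c * X ^ k) :
    cyclotomic m ℤ ∣ f - C (-c) * X ^ (q * k % m) := by
  have hζ := Complex.isPrimitiveRoot_exp m hm.ne'
  set ζ := Complex.exp (2 * Real.pi * Complex.I / m)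
  have hcop : Nat.Coprime q m := by
    have := hpq.gcd_eq
    rw [Nat.gcd_one_left] at this
    exact Nat.Coprime.coprime_mul_left this
  have hpow : ∀ x y, x ≡ y [MOD m] → ζ ^ x = ζ ^ y := by
    intro x y hxy
    rw [← pow_mod_orderOf ζ x, ← pow_mod_orderOf ζ y, ← hζ.eq_orderOf, hxy]
  -- ζ^q is again a primitive root, and substituting it for X turns X^p into ζ.
  have hzero : aeval (ζ ^ q) (cyclotomic m ℤ) = 0 := by
    rw [cyclotomic_eq_minpoly (hζ.pow_of_coprime q hcop) hm, minpoly.aeval]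
  rw [cyclotomic_eq_minpoly hζ hm]
  refine minpoly.isIntegrallyClosed_dvd (hζ.isIntegral hm) ?_
  obtain ⟨Q, hQ⟩ := h
  have := congrArg (aeval (ζ ^ q)) hQ
  rw [map_mul, hzero, zero_mul, map_add, expand_aeval, ← pow_mul, hpow (q * p) 1 (by
    rwa [mul_comm]), pow_one, map_mul, map_pow, aeval_X, aeval_C, ← pow_mul,
    hpow (q * k) (q * k % m) (Nat.mod_modEq _ _).symm] at this
  rw [map_sub, map_mul, map_pow, aeval_X, aeval_C, map_neg, ← this]
  ring

theorem exists_cyclotomic_dvd_lowPart_sub (hm : 0 < m) (hp : p.Prime) (hpm : ¬ p ∣ m) {a k : ℕ}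
    (hgap : IsGap (cyclotomic (m * p) ℤ) a k) (hk : a + m.totient ≤ k) :
    ∃ q, p * q ≡ 1 [MOD m] ∧
      cyclotomic m ℤ ∣ lowPart ((k - 1) / p + 1) (cyclotomic m ℤ) -
        C (-(cyclotomic m ℤ * lowPart k (cyclotomic (m * p) ℤ)).coeff k) *
          X ^ (q * k % m) := by
  obtain ⟨q, -, hq⟩ := Nat.exists_mul_mod_eq_of_coprime 1
    ((Nat.Prime.coprime_iff_not_dvd hp).mpr hpm) hm.ne'
  refine ⟨q, hq, cyclotomic_dvd_of_dvd_expand hm hq ?_⟩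
  rw [← cyclotomic_mul_lowPart_eq hp hpm hgap hk]
  exact dvd_mul_right _ _

theorem isGap_cyclotomic_le (hm : 0 < m) (hp : p.Prime) (hpm : ¬ p ∣ m) {a k : ℕ}
    (hgap : IsGap (cyclotomic (m * p) ℤ) a k) : k ≤ a + m.totient := by
  by_contra! hlt
  obtain ⟨q, -, h⟩ := exists_cyclotomic_dvd_lowPart_sub hm hp hpm hgap hlt.le
  have hc : (cyclotomic m ℤ * lowPart k (cyclotomic (m * p) ℤ)).coeff k = 0 := by
    have := natDegree_lowPart_le_of_isGap hgap
    refine coeff_eq_zero_of_natDegree_lt (lt_of_le_of_lt natDegree_mul_le ?_)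
    rw [natDegree_cyclotomic]
    omega
  rw [hc, neg_zero, C_0, zero_mul, sub_zero] at h
  have hdeg := natDegree_lowPart_succ_le ((k - 1) / p) (cyclotomic m ℤ)
  have h0 := eq_zero_of_dvd_of_natDegree_lt h (by
    rw [natDegree_cyclotomic]
    exact hdeg.trans_lt (div_lt_totient_of_isGap hp hpm hgap))
  have h1 := congrArg (fun f => f.coeff 0) h0
  simp only [coeff_lowPart, Nat.succ_pos, if_true, coeff_zero] at h1
  exact cyclotomic_coeff_zero_ne_zero hm h1

theorem not_isGap_totient_of_lt (hm : 0 < m) (hs : Squarefree m)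
    (hbound : m < 2 * m.totient ∨ ∃ n, m = 3 * n ∧ n < m.totient)
    (hp : p.Prime) (hpm : ¬ p ∣ m) (hlt : p < m) (a : ℕ) :
    ¬ IsGap (cyclotomic (m * p) ℤ) a (a + m.totient) := by
  intro hgap
  obtain ⟨q, hpq, h⟩ := exists_cyclotomic_dvd_lowPart_sub hm hp hpm hgap le_rfl
  have hle := le_of_isGap hp hpm hgap
  have hj := div_lt_totient_of_isGap hp hpm hgap
  have hk0 : 0 < a + m.totient := (Nat.zero_le a).trans_lt hgap.1
  generalize a + m.totient = k at *
  have hmod := Nat.div_add_mod (k - 1) p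
  have hmodlt := Nat.mod_lt (k - 1) hp.pos
  have hpk : p * (q * k % m) ≡ k [MOD m] := by
    calc p * (q * k % m) ≡ p * (q * k) [MOD m] := (Nat.mod_modEq _ _).mul_left _
      _ = p * q * k := by ring
      _ ≡ 1 * k [MOD m] := hpq.mul_right _
      _ = k := one_mul k
  rcases lowPart_cyclotomic_eq_monomial (hp.one_lt.trans hlt) hs hbound hj
    (Nat.mod_lt _ hm) h with ⟨hj0, hr0⟩ | ⟨hj1, hr1⟩
  -- Here m ∣ k although 0 < k ≤ p < m.
  · rw [hr0, mul_zero] at hpk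
    rw [hj0, mul_zero] at hmod
    have := Nat.le_of_dvd hk0 ((Nat.modEq_zero_iff_dvd).mp hpk.symm)
    omega
  -- Here m divides p φ(m) - k, which lies strictly between 0 and p.
  · rw [hr1] at hpk
    have hkd : k + m.totient ≤ p * m.totient := by
      calc k + m.totient ≤ m.totient * (p - 1) + m.totient := Nat.add_le_add_right hle _
        _ = m.totient * (p - 1 + 1) := by ring
        _ = p * m.totient := by rw [Nat.sub_add_cancel hp.one_le, mul_comm]
    have hd : 0 < m.totient := Nat.totient_pos.mpr hm
    have hdvd := (Nat.modEq_iff_dvd' (by omega)).mp hpk.symm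
    have := Nat.le_of_dvd (by omega) hdvd
    rw [← hj1, mul_add, mul_one] at this
    omega

theorem isGap_cyclotomic_of_lt (hm : 0 < m) (hp : p.Prime) (hpm : ¬ p ∣ m) (hlt : m < p) :
    IsGap (cyclotomic (m * p) ℤ) (m - m.totient) (m - m.totient + m.totient) := by
  have hle := Nat.totient_le m
  have hd : 0 < m.totient := Nat.totient_pos.mpr hm
  rw [Nat.sub_add_cancel hle]
  obtain ⟨P, hP'⟩ := cyclotomic.dvd_X_pow_sub_one m ℤ
  have hP : cyclotomic m ℤ * P = X ^ m - 1 := hP'.symm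
  have hdeg := complement_natDegree hm hP
  have hPdeg : P.natDegree = m - m.totient := by omega
  have hc0 := cyclotomic_coeff_zero_ne_zero hm
  have key : ∀ i, i < p → (if m ≤ i then (cyclotomic (m * p) ℤ).coeff (i - m) else 0) -
      (cyclotomic (m * p) ℤ).coeff i = P.coeff i * (cyclotomic m ℤ).coeff 0 := by
    intro i hi
    have h1 : (X ^ m - 1) * cyclotomic (m * p) ℤ = P * expand ℤ p (cyclotomic m ℤ) := by
      rw [cyclotomic_expand_eq_cyclotomic_mul hp hpm, ← hP]
      ring
    have h2 := congrArg (fun f => f.coeff i) h1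
    simp only [sub_mul, one_mul, coeff_sub, coeff_X_pow_mul'] at h2
    rw [h2, coeff_mul_congr (h := C ((cyclotomic m ℤ).coeff 0)), coeff_mul_C]
    intro l hl
    rw [coeff_expand hp.pos, coeff_C]
    rcases Nat.eq_zero_or_pos l with rfl | hl0
    · simp
    · rw [if_neg (Nat.not_dvd_of_pos_of_lt hl0 (by omega)), if_neg hl0.ne']
  refine ⟨by omega, fun h0 => ?_, fun h0 => ?_, fun i hi hi' => ?_⟩
  · have := key (m - m.totient) (by omega)
    rw [if_neg (by omega), h0, ← hPdeg, (complement_monic hm hP).coeff_natDegree] at this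
    exact hc0 (by linarith)
  · have := key m hlt
    rw [if_pos le_rfl, h0, Nat.sub_self, coeff_eq_zero_of_natDegree_lt (p := P) (by omega),
      zero_mul, sub_zero] at this
    exact cyclotomic_coeff_zero_ne_zero (Nat.mul_pos hm hp.pos) this
  · have := key i (by omega)
    rw [if_neg (by omega), coeff_eq_zero_of_natDegree_lt (p := P) (by omega), zero_mul] at this
    linarith

end Gaps

end CyclotomicGap

open CyclotomicGap in
theorem theorem8 (m p : ℕ) (hm_odd : Odd m) (hm_sqf : Squarefree m) (hm_lt : m < 1000)
    (hp : p.Prime) (hp_odd : Odd p) (hp_larger : ∀ q : ℕ, q.Prime → q ∣ m → q < p) :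
    maxGap (Polynomial.cyclotomic (m * p) ℤ) = Nat.totient m ↔ m < p := by
  have hm : 0 < m := hm_odd.pos
  have hpm : ¬ p ∣ m := fun h => (hp_larger p hp h).false
  constructor
  · intro h
    by_contra hle
    have hlt : p < m := lt_of_le_of_ne (not_lt.mp hle) (fun h => hpm h.dvd)
    obtain ⟨a, ha⟩ := exists_isGap_of_maxGap_eq (Nat.totient_pos.mpr hm) h
    exact not_isGap_totient_of_lt hm hm_sqf (lt_two_mul_totient_or hm_odd hm_sqf hm_lt)
      hp hpm hlt a ha
  · intro hlt
    exact maxGap_eq_of_isGap (isGap_cyclotomic_of_lt hm hp hpm hlt)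
      (fun _ _ => isGap_cyclotomic_le hm hp hpm)
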